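/- Let $\Omega$ be a Polish space, $\mu$ a probability measure on $\Omega$, and $\lambda$ a strictly positive continuous function on $(0,\infty)$ with $\int_0^\infty \min\{1,t\}\lambda(t)\,dt<\infty$. Let $(J_n,\omega_n)$ be the points of a Poisson process on $(0,\infty)\times\Omega$ with mean measure $\lambda(t)\,dt\,\mu(d\omega)$, and put $N:=\sum_n J_n\delta_{\omega_n}$, so that $N(\Omega)<\infty$ almost surely. Let $M_0$ and $M$ be random measures on $\Omega$ with laws $$\mathbb P(M_0\in dm)=h_0(m(\Omega))\,\mathbb P(N\in dm),\qquad \mathbb P(M\in dm)=h(m(\Omega))\,\mathbb P(N\in dm),$$ where $h_0,h\ge 0$ are measurable functions with $\mathbb E[h_0(N(\Omega))]=\mathbb E[h(N(\Omega))]=1$. Let $\xi$ be a real random variable defined on the same probability space as $M$, let $\psi(s):=-\log\mathbb E[e^{-sM_0(\Omega)}]$ for $s\ge 0$, and fix $\nu>0$ such that $\mathbb E[M_0(\Omega)^{-\nu}]<\infty$ (with $0^{-\nu}=\infty$). Then the three conditions (i) $M$ and $\xi M(\Omega)$ are independent, (ii) $\xi M(\Omega)$ has the $\mathrm{Gamma}(\nu,1)$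 distribution, (iii) $\displaystyle \mathbb P(M(\Omega)\in dt)=\frac{t^{-\nu}}{\mathbb E[M_0(\Omega)^{-\nu}]}\,\mathbb P(M_0(\Omega)\in dt)$ all hold if and only if $\xi$ has the law $$\mathbb P_{\psi,\nu}(ds)=\frac{e^{-\psi(s)}s^{\nu-1}}{\mathbb E[M_0(\Omega)^{-\nu}]\,\Gamma(\nu)}\,ds\qquad\text{on }(0,\infty)$$ and the conditional law of $M$ given $\xi=s$ is, for almost every $s$, the exponentially tilted law $$\mathbb P(M_0^{(s)}\in dm)=e^{\psi(s)-s\,m(\Omega)}\,\mathbb P(M_0\in dm).$$ -/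

import Mathlib

open MeasureTheory ProbabilityTheory Set
open scoped ENNReal NNReal

/-- Lévy densities on `(0, ∞)`: strictly positive, continuous, with
`∫₀^∞ min(1, t) lam(t) dt < ∞`. -/
structure IsLevyDensity (lam : ℝ → ℝ) : Prop where
  pos : ∀ t, 0 < t → 0 < lam t
  continuousOn : ContinuousOn lam (Ioi 0)
  lintegral_lt_top : ∫⁻ t in Ioi (0 : ℝ), ENNReal.ofReal (min 1 t * lam t) < ∞

/-- The counting measure `∑_{n < K} δ_{Z n}` of the points `Z 0, Z 1, …` of a point process with
`K ∈ {0, 1, …, ∞}` points (counted with multiplicity), as a function of the outcome `x`. -/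
noncomputable def pointMeasure {X E : Type*} [MeasurableSpace E]
    (K : X → ℕ∞) (Z : ℕ → X → E) (x : X) : Measure E :=
  open Classical in
  Measure.sum fun n : ℕ => if (n : ℕ∞) < K x then Measure.dirac (Z n x) else 0

/-- The random points `Z n`, `n < K`, are the points of a Poisson process with (σ-finite) mean
measure `Λ`: the number of points in a measurable set `A` with `Λ A < ∞` is Poisson with
mean `Λ A`, and the numbers of points in disjoint sets are independent. -/
structure IsPoissonProcess {X E : Type*} [MeasurableSpace X] [MeasurableSpace E]
    (Λ : Measure E) (K : X → ℕ∞) (Z : ℕ → X → E) (P : Measure X) : Prop where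
  measurable_count : Measurable K
  measurable_point : ∀ n, Measurable (Z n)
  map_eq_poisson : ∀ A : Set E, MeasurableSet A → Λ A ≠ ∞ →
    P.map (fun x => pointMeasure K Z x A) =
      (poissonMeasure (Λ A).toNNReal).map (fun k : ℕ => (k : ℝ≥0∞))
  indep : ∀ (k : ℕ) (A : Fin k → Set E), (∀ i, MeasurableSet (A i)) →
    Pairwise (fun i j => Disjoint (A i) (A j)) →
    iIndepFun (fun i x => pointMeasure K Z x (A i)) P

/-- The measure `lam(t) dt μ(dω)` on `(0, ∞) × Ω`, viewed as a measure on `ℝ × Ω`. -/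
noncomputable def levyMean {Ω : Type*} [MeasurableSpace Ω] (lam : ℝ → ℝ) (μ : Measure Ω) :
    Measure (ℝ × Ω) :=
  ((volume.restrict (Ioi (0 : ℝ))).withDensity fun t => ENNReal.ofReal (lam t)).prod μ

/-- The random measure `∑_{n < K} J n • δ_{loc n}`, as a function of the outcome `x`. -/
noncomputable def jumpMeasure {X Ω : Type*} [MeasurableSpace Ω]
    (K : X → ℕ∞) (J : ℕ → X → ℝ) (loc : ℕ → X → Ω) (x : X) : Measure Ω :=
  open Classical in
  Measure.sum fun n : ℕ =>
    if (n : ℕ∞) < K x then ENNReal.ofReal (J n x) • Measure.dirac (loc n x) else 0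

/-- `N` is the random measure `∑ₙ Jₙ δ_{ωₙ}` built from the points `(Jₙ, ωₙ)` of a Poisson process
on `(0, ∞) × Ω` with mean measure `lam(t) dt μ(dω)`. -/
def IsPoissonRandomMeasure {X Ω : Type*} [MeasurableSpace X] [MeasurableSpace Ω]
    (lam : ℝ → ℝ) (μ : Measure Ω) (N : X → Measure Ω) (P : Measure X) : Prop :=
  ∃ (K : X → ℕ∞) (J : ℕ → X → ℝ) (loc : ℕ → X → Ω),
    (∀ (n : ℕ) (x : X), (n : ℕ∞) < K x → 0 < J n x) ∧
    IsPoissonProcess (levyMean lam μ) K (fun n x => (J n x, loc n x)) P ∧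
    ∀ x, N x = jumpMeasure K J loc x

/-- The total mass of a random measure, as a real random variable. -/
noncomputable def totalMass {X Ω : Type*} [MeasurableSpace Ω] (M : X → Measure Ω) (x : X) : ℝ :=
  (M x).real univ

/-- `M` is a random measure with law `P(M ∈ dm) = h(m(Ω)) P(N ∈ dm)`, where `h` is a nonnegative
measurable function with `E[h(N(Ω))] = 1`. -/
structure IsWeightedBy {Y X Ω : Type*} [MeasurableSpace Y] [MeasurableSpace X] [MeasurableSpace Ω]
    (N : Y → Measure Ω) (Q : Measure Y) (h : ℝ → ℝ≥0) (M : X → Measure Ω) (P : Measure X) :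
    Prop where
  measurable_weight : Measurable h
  lintegral_weight : ∫⁻ y, (h (totalMass N y) : ℝ≥0∞) ∂Q = 1
  measurable : Measurable M
  map_eq : P.map M = (Q.map N).withDensity fun m => (h (m.real univ) : ℝ≥0∞)

/-- The cumulant function `ψ(s) = -log E[exp(-s T)]`. -/
noncomputable def cumulant {X : Type*} [MeasurableSpace X] (T : X → ℝ) (P : Measure X) (s : ℝ) :
    ℝ :=
  -Real.log (∫ x, Real.exp (-(s * T x)) ∂P)

/-- The moment `E[T ^ (-ν)] ∈ [0, ∞]` of a nonnegative `T`, where `0 ^ (-ν) = ∞`. -/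
noncomputable def negMoment {X : Type*} [MeasurableSpace X] (T : X → ℝ) (P : Measure X) (ν : ℝ) :
    ℝ≥0∞ :=
  ∫⁻ x, ENNReal.ofReal (T x) ^ (-ν) ∂P

/-- The law of the polynomially tilted variable `T^[ν]`:
`P(T^[ν] ∈ dt) = t ^ (-ν) / E[T ^ (-ν)] P(T ∈ dt)`. -/
noncomputable def polyTilt {X : Type*} [MeasurableSpace X] (T : X → ℝ) (P : Measure X) (ν : ℝ) :
    Measure ℝ :=
  (P.map T).withDensity fun t => ENNReal.ofReal t ^ (-ν) / negMoment T P ν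

/-- The law of the exponentially tilted random measure `M^(s)`:
`P(M^(s) ∈ dm) = exp(ψ(s) - s m(Ω)) P(M ∈ dm)`, with `ψ` the cumulant function of `M(Ω)`. -/
noncomputable def expTilt {X Ω : Type*} [MeasurableSpace X] [MeasurableSpace Ω]
    (M : X → Measure Ω) (P : Measure X) (s : ℝ) : Measure (Measure Ω) :=
  (P.map M).withDensity fun m =>
    ENNReal.ofReal (Real.exp (cumulant (totalMass M) P s - s * m.real univ))

/-- The mixing law `P_{ψ,ν}(ds) = exp(-ψ(s)) s ^ (ν - 1) / (E[T ^ (-ν)] Γ(ν)) ds` on `(0, ∞)`, with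
`ψ` the cumulant function of `T`. -/
noncomputable def mixingLaw {X : Type*} [MeasurableSpace X] (T : X → ℝ) (P : Measure X) (ν : ℝ) :
    Measure ℝ :=
  (volume.restrict (Ioi (0 : ℝ))).withDensity fun s =>
    ENNReal.ofReal (Real.exp (-cumulant T P s) * s ^ (ν - 1) /
      ((negMoment T P ν).toReal * Real.Gamma ν))

/-- The family of laws `κ s` is a version of the conditional law of `Y` given `ξ = s`. -/
def HasCondLaw {X S : Type*} [MeasurableSpace X] [MeasurableSpace S]
    (Y : X → S) (ξ : X → ℝ) (κ : ℝ → Measure S) (P : Measure X) : Prop :=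
  (∀ A : Set S, MeasurableSet A → AEMeasurable (fun s => κ s A) (P.map ξ)) ∧
  ∀ (A : Set S) (B : Set ℝ), MeasurableSet A → MeasurableSet B →
    P (Y ⁻¹' A ∩ ξ ⁻¹' B) = ∫⁻ s in B, κ s A ∂(P.map ξ)

/-!
Both sides of the equivalence describe the joint law of `(M, ξ)`, and they describe the same one,
namely the measure `gammaQuotientLaw` with density `s ^ (ν - 1) exp(-s m(Ω)) / (E[M₀(Ω)^(-ν)] Γ(ν))`
with respect to `P(M₀ ∈ dm) ds` on `s > 0`.

* Integrating out `m` first: the factorization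
  `exp(-s m(Ω)) = exp(-ψ(s)) exp(ψ(s) - s m(Ω))` exhibits the mixing law of `s` and the
  exponentially tilted law of `m` given `s`
  (`gammaQuotientLaw_prod_eq_lintegral_expTilt`, `mixingLaw_and_hasCondLaw_iff_map_eq`).
* Integrating out `s` first: for fixed `m`, the substitution `g = s m(Ω)` turns the density into
  the product of `m(Ω) ^ (-ν) / E[M₀(Ω)^(-ν)]` and the `Gamma(ν, 1)` density in `g`
  (`map_mul_gammaQuotientLaw`). Since `(m, s) ↦ (m, s m(Ω))` is almost surely invertible, the joint
  law of `(M, ξ)` is this one if and only if `M` and `ξ M(Ω)` are independent, `ξ M(Ω)` is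
  `Gamma(ν, 1)`, and `M` itself has the law of `M₀` tilted by `m(Ω) ^ (-ν)`
  (`indepFun_and_map_eq_iff_map_eq`).

Condition (iii) speaks only about the law of the total mass. It is equivalent to the statement
about the law of `M` because both `M` and `M₀` are obtained from `N` by weights that depend only on
the total mass (`map_totalMass_eq_polyTilt_iff`). That
`M₀(Ω)` is almost surely positive and finite follows from the finite negative moment
(`ae_pos_of_negMoment_lt_top`).
-/

/-! ### The joint law of a random element and an independent gamma variable divided by its size -/

/-- The measure `s ^ (ν - 1) exp(-s T(x)) / (c Γ(ν)) ρ(dx) ds` on `S × (0, ∞)`, viewed as a measure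
on `S × ℝ`. -/
noncomputable def gammaQuotientLaw {S : Type*} [MeasurableSpace S] (ρ : Measure S) (T : S → ℝ)
    (ν c : ℝ) : Measure (S × ℝ) :=
  (ρ.prod (volume.restrict (Ioi (0 : ℝ)))).withDensity fun p =>
    ENNReal.ofReal (p.2 ^ (ν - 1) * Real.exp (-(p.2 * T p.1)) / (c * Real.Gamma ν))

/-- The substitution `g = s t` in an integral against the `Gamma(ν, 1)` distribution. -/
lemma lintegral_Ioi_rpow_mul_exp_comp_mul {ν c t : ℝ} (hν : 0 < ν) (hc : 0 < c) (ht : 0 < t)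
    {f : ℝ → ℝ≥0∞} (hf : Measurable f) :
    ∫⁻ s in Ioi (0 : ℝ),
        ENNReal.ofReal (s ^ (ν - 1) * Real.exp (-(s * t)) / (c * Real.Gamma ν)) * f (s * t) =
      ENNReal.ofReal t ^ (-ν) / ENNReal.ofReal c * ∫⁻ g, f g ∂gammaMeasure ν 1 := by
  have hΓ := Real.Gamma_pos_of_pos hν
  have hpdf : Measurable (gammaPDF ν 1) := (measurable_gammaPDFReal ν 1).ennreal_ofReal
  have hmul : Measurable (gammaPDF ν 1 * f) := hpdf.mul hf
  have hscale : Measurable fun s : ℝ => s * t := measurable_id.mul_const t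
  have hsupp : ∫⁻ s, (gammaPDF ν 1 * f) (s * t) =
      ∫⁻ s in Ioi (0 : ℝ), (gammaPDF ν 1 * f) (s * t) := by
    rw [← setLIntegral_univ, ← setLIntegral_congr (Ioi_ae_eq_Ici (a := (0 : ℝ)) (μ := volume)).symm,
      setLIntegral_univ, setLIntegral_eq_of_support_subset]
    intro s hs
    by_contra hneg
    refine hs ?_
    have : s * t < 0 := mul_neg_of_neg_of_pos (not_le.mp hneg) ht
    simp [gammaPDF_of_neg this]
  -- the volume in both integrals is written as `|t|` times its image under `s ↦ s t`,
  -- and the one on the left is then restored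
  rw [gammaMeasure, lintegral_withDensity_eq_lintegral_mul _ hpdf hf,
    ← Real.smul_map_volume_mul_right ht.ne', lintegral_smul_measure,
    Real.smul_map_volume_mul_right ht.ne', lintegral_map hmul hscale, hsupp, smul_eq_mul,
    ← mul_assoc, ← lintegral_const_mul _ (show Measurable fun s => (gammaPDF ν 1 * f) (s * t) from
      hmul.comp hscale)]
  refine setLIntegral_congr_fun measurableSet_Ioi fun s hs => ?_
  have hs : 0 < s := hs
  rw [Pi.mul_apply, ← mul_assoc, gammaPDF_of_nonneg (mul_pos hs ht).le,
    ENNReal.ofReal_rpow_of_pos ht, ← ENNReal.ofReal_div_of_pos hc, abs_of_pos ht,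
    ← ENNReal.ofReal_mul (by positivity), ← ENNReal.ofReal_mul (by positivity)]
  congr 2
  rw [Real.one_rpow, one_mul, Real.mul_rpow hs.le ht.le, Real.rpow_neg ht.le,
    Real.rpow_sub_one ht.ne']
  have := (Real.rpow_pos_of_pos ht ν).ne'
  field_simp

section GammaQuotient

variable {S : Type*} [MeasurableSpace S] {ρ : Measure S} {T : S → ℝ} {ν c : ℝ}

lemma measurable_gammaQuotientDensity (hT : Measurable T) (ν c : ℝ) :
    Measurable fun p : S × ℝ =>
      ENNReal.ofReal (p.2 ^ (ν - 1) * Real.exp (-(p.2 * T p.1)) / (c * Real.Gamma ν)) := by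
  fun_prop

/-- Under `gammaQuotientLaw`, the product `s T(x)` is gamma distributed and independent of `x`,
and the law of `x` is the polynomial tilt of `ρ`. -/
lemma map_mul_gammaQuotientLaw (hT : Measurable T) (hpos : ∀ᵐ x ∂ρ, 0 < T x)
    (hν : 0 < ν) (hc : 0 < c) :
    (gammaQuotientLaw ρ T ν c).map (fun p => (p.1, p.2 * T p.1)) =
      (ρ.withDensity fun x => ENNReal.ofReal (T x) ^ (-ν) / ENNReal.ofReal c).prod
        (gammaMeasure ν 1) := by
  have := isProbabilityMeasure_gammaMeasure hν one_pos
  have hφ : Measurable fun p : S × ℝ => (p.1, p.2 * T p.1) := by fun_prop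
  have hw : Measurable fun x => ENNReal.ofReal (T x) ^ (-ν) / ENNReal.ofReal c := by fun_prop
  have hd := measurable_gammaQuotientDensity hT ν c
  refine Measure.ext_of_lintegral _ fun f hf => ?_
  have hfφ : Measurable fun p : S × ℝ => f (p.1, p.2 * T p.1) := hf.comp hφ
  rw [lintegral_map hf hφ, gammaQuotientLaw, lintegral_withDensity_eq_lintegral_mul _ hd hfφ,
    lintegral_prod _ (hd.mul hfφ).aemeasurable, lintegral_prod _ hf.aemeasurable,
    lintegral_withDensity_eq_lintegral_mul _ hw hf.lintegral_prod_right']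
  refine lintegral_congr_ae (hpos.mono fun x hx => ?_)
  exact lintegral_Ioi_rpow_mul_exp_comp_mul hν hc hx (hf.comp measurable_prodMk_left)

/-- A property that holds for `ρ`-almost every `x` holds almost surely under `gammaQuotientLaw`. -/
lemma ae_fst_gammaQuotientLaw {p : S → Prop} (h : ∀ᵐ x ∂ρ, p x) :
    ∀ᵐ q ∂gammaQuotientLaw ρ T ν c, p q.1 :=
  (withDensity_absolutelyContinuous _ _).ae_le (Measure.quasiMeasurePreserving_fst.ae h)

/-- The converse of `map_mul_gammaQuotientLaw`: dividing an independent gamma variable by `T(x)`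
gives `gammaQuotientLaw`. -/
lemma map_div_prod_gammaMeasure (hT : Measurable T) (hpos : ∀ᵐ x ∂ρ, 0 < T x)
    (hν : 0 < ν) (hc : 0 < c) :
    ((ρ.withDensity fun x => ENNReal.ofReal (T x) ^ (-ν) / ENNReal.ofReal c).prod
        (gammaMeasure ν 1)).map (fun p => (p.1, p.2 / T p.1)) =
      gammaQuotientLaw ρ T ν c := by
  rw [← map_mul_gammaQuotientLaw hT hpos hν hc, Measure.map_map (by fun_prop) (by fun_prop)]
  conv_rhs => rw [← Measure.map_id (μ := gammaQuotientLaw ρ T ν c)]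
  refine Measure.map_congr ((ae_fst_gammaQuotientLaw hpos).mono fun q hq => ?_)
  simp [hq.ne']

lemma gammaQuotientLaw_prod [SFinite ρ] (hT : Measurable T) {A : Set S} {B : Set ℝ} (hA : MeasurableSet A)
    (hB : MeasurableSet B) :
    gammaQuotientLaw ρ T ν c (A ×ˢ B) = ∫⁻ s in B, ∫⁻ x in A,
      ENNReal.ofReal (s ^ (ν - 1) * Real.exp (-(s * T x)) / (c * Real.Gamma ν)) ∂ρ
        ∂(volume.restrict (Ioi (0 : ℝ))) := by
  rw [gammaQuotientLaw, withDensity_apply _ (hA.prod hB), ← Measure.prod_restrict,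
    lintegral_prod_symm _ (measurable_gammaQuotientDensity hT ν c).aemeasurable]

end GammaQuotient

/-! ### Weighted and tilted laws of random measures -/

lemma map_withDensity_comp {S R : Type*} [MeasurableSpace S] [MeasurableSpace R] (ρ : Measure S)
    {T : S → R} (hT : Measurable T) {f : R → ℝ≥0∞} (hf : Measurable f) :
    (ρ.withDensity fun x => f (T x)).map T = (ρ.map T).withDensity f := by
  ext B hB
  rw [Measure.map_apply hT hB, withDensity_apply _ (hT hB), withDensity_apply _ hB,
    setLIntegral_map hB hf hT]

/-- Two laws obtained from `η` by weights that depend only on `T` are proportional to each other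
by a function of `T` as soon as their images under `T` are. -/
lemma withDensity_comp_eq_of_map_eq {S R : Type*} [MeasurableSpace S] [MeasurableSpace R]
    (η : Measure S) {T : S → R} (hT : Measurable T) {f f₀ g : R → ℝ≥0∞} (hf : Measurable f)
    (hf₀ : Measurable f₀) (hg : Measurable g) (hfin : ∫⁻ x, f (T x) ∂η ≠ ∞)
    (h : (η.withDensity fun x => f (T x)).map T =
      ((η.withDensity fun x => f₀ (T x)).map T).withDensity g) :
    (η.withDensity fun x => f (T x)) =
      (η.withDensity fun x => f₀ (T x)).withDensity fun x => g (T x) := by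
  rw [map_withDensity_comp η hT hf, map_withDensity_comp η hT hf₀, ← withDensity_mul _ hf₀ hg,
    withDensity_eq_iff hf.aemeasurable (hf₀.mul hg).aemeasurable (by rwa [lintegral_map hf hT])] at h
  have hmul := withDensity_mul η (hf₀.comp hT) (hg.comp hT)
  simp only [Function.comp_def] at hmul
  rw [← hmul]
  exact withDensity_congr_ae (ae_of_ae_map hT.aemeasurable h)

lemma measurable_real_univ {Ω : Type*} [MeasurableSpace Ω] :
    Measurable fun m : Measure Ω => m.real univ :=
  (Measure.measurable_coe MeasurableSet.univ).ennreal_toReal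

section Tilt

variable {X Ω : Type*} [MeasurableSpace X] [MeasurableSpace Ω] {M : X → Measure Ω}
  {P : Measure X} {ν : ℝ}

lemma measurable_totalMass (hM : Measurable M) : Measurable (totalMass M) :=
  measurable_real_univ.comp hM

lemma negMoment_totalMass_eq_lintegral_map (hM : Measurable M) (ν : ℝ) :
    negMoment (totalMass M) P ν =
      ∫⁻ m, ENNReal.ofReal (m.real univ) ^ (-ν) ∂P.map M := by
  have : Measurable fun m : Measure Ω => ENNReal.ofReal (m.real univ) ^ (-ν) :=
    measurable_real_univ.ennreal_ofReal.pow_const _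
  rw [lintegral_map this hM]
  rfl

/-- A finite negative moment excludes zero total mass. It also excludes infinite total mass, for
which `totalMass` takes the value `0`. -/
lemma ae_pos_of_negMoment_lt_top (hM : Measurable M) (hν : 0 < ν)
    (hmom : negMoment (totalMass M) P ν < ∞) : ∀ᵐ m ∂P.map M, 0 < m.real univ := by
  have hw : Measurable fun m : Measure Ω => ENNReal.ofReal (m.real univ) ^ (-ν) :=
    measurable_real_univ.ennreal_ofReal.pow_const _
  rw [negMoment_totalMass_eq_lintegral_map hM] at hmom
  filter_upwards [ae_lt_top hw hmom.ne] with m hm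
  by_contra hle
  rw [ENNReal.ofReal_of_nonpos (not_lt.mp hle), ENNReal.zero_rpow_of_neg (neg_lt_zero.mpr hν)] at hm
  exact hm.ne rfl

lemma negMoment_toReal_pos [IsProbabilityMeasure P] (hM : Measurable M) (hν : 0 < ν)
    (hmom : negMoment (totalMass M) P ν < ∞) : 0 < (negMoment (totalMass M) P ν).toReal := by
  refine ENNReal.toReal_pos (fun h0 => ?_) hmom.ne
  have hT := measurable_totalMass hM
  rw [negMoment, lintegral_eq_zero_iff (hT.ennreal_ofReal.pow_const _)] at h0
  obtain ⟨x, hx⟩ := h0.exists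
  simp only [Pi.zero_apply, ENNReal.rpow_eq_zero_iff, ENNReal.ofReal_ne_top, false_and,
    or_false] at hx
  linarith [hx.2]

variable [IsProbabilityMeasure P]

lemma integrable_exp_neg_mul_totalMass (hM : Measurable M) {s : ℝ} (hs : 0 ≤ s) :
    Integrable (fun x => Real.exp (-(s * totalMass M x))) P := by
  have hT := measurable_totalMass hM
  refine Integrable.of_bound (C := 1) (by fun_prop) (.of_forall fun x => ?_)
  have : 0 ≤ totalMass M x := measureReal_nonneg
  rw [Real.norm_eq_abs, Real.abs_exp, Real.exp_le_one_iff]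
  nlinarith

lemma exp_neg_cumulant_totalMass (hM : Measurable M) {s : ℝ} (hs : 0 ≤ s) :
    Real.exp (-cumulant (totalMass M) P s) = ∫ x, Real.exp (-(s * totalMass M x)) ∂P := by
  rw [cumulant, neg_neg, Real.exp_log]
  exact integral_exp_pos (integrable_exp_neg_mul_totalMass hM hs)

lemma measurable_cumulant {T : X → ℝ} (hT : Measurable T) : Measurable (cumulant T P) := by
  have : StronglyMeasurable (Function.uncurry fun (s : ℝ) x => Real.exp (-(s * T x))) :=
    Measurable.stronglyMeasurable (by unfold Function.uncurry; fun_prop)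
  exact (Real.measurable_log.comp this.integral_prod_right.measurable).neg

lemma measurable_expTilt_apply (hM : Measurable M) {A : Set (Measure Ω)} (hA : MeasurableSet A) :
    Measurable fun s => expTilt M P s A := by
  have := Measure.isProbabilityMeasure_map (μ := P) hM.aemeasurable
  have hψ := measurable_cumulant (P := P) (measurable_totalMass hM)
  have hT : Measurable fun m : Measure Ω => m.real univ := measurable_real_univ
  simp only [expTilt, withDensity_apply _ hA]
  refine Measurable.lintegral_prod_right' (f := fun q : ℝ × Measure Ω =>
    ENNReal.ofReal (Real.exp (cumulant (totalMass M) P q.1 - q.1 * q.2.real univ))) ?_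
  exact (Real.measurable_exp.comp
    ((hψ.comp measurable_fst).sub (measurable_fst.mul (hT.comp measurable_snd)))).ennreal_ofReal

lemma expTilt_univ (hM : Measurable M) {s : ℝ} (hs : 0 ≤ s) : expTilt M P s univ = 1 := by
  have hm : Measurable fun m : Measure Ω => ENNReal.ofReal
      (Real.exp (cumulant (totalMass M) P s - s * m.real univ)) :=
    (Real.measurable_exp.comp
      (measurable_const.sub (measurable_real_univ.const_mul s))).ennreal_ofReal
  have hint := integrable_exp_neg_mul_totalMass (P := P) hM hs
  rw [expTilt, withDensity_apply _ MeasurableSet.univ, setLIntegral_univ, lintegral_map hm hM]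
  change ∫⁻ x, ENNReal.ofReal
    (Real.exp (cumulant (totalMass M) P s - s * totalMass M x)) ∂P = 1
  simp only [sub_eq_add_neg, Real.exp_add]
  rw [← ofReal_integral_eq_lintegral_ofReal (hint.const_mul _) (.of_forall fun x => by positivity),
    integral_const_mul, ← exp_neg_cumulant_totalMass hM hs, ← Real.exp_add, add_neg_cancel,
    Real.exp_zero, ENNReal.ofReal_one]

/-- `gammaQuotientLaw` disintegrates over its second coordinate: the mixing law governs `s`, and
given `s` the first coordinate has the exponentially tilted law. -/
lemma gammaQuotientLaw_prod_eq_lintegral_expTilt (hM : Measurable M) (hν : 0 < ν)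
    {A : Set (Measure Ω)} {B : Set ℝ} (hA : MeasurableSet A) (hB : MeasurableSet B) :
    gammaQuotientLaw (P.map M) (fun m => m.real univ) ν (negMoment (totalMass M) P ν).toReal
        (A ×ˢ B) =
      ∫⁻ s in B, expTilt M P s A ∂mixingLaw (totalMass M) P ν := by
  have := Measure.isProbabilityMeasure_map (μ := P) hM.aemeasurable
  have hΓ := Real.Gamma_pos_of_pos hν
  have hψ := measurable_cumulant (P := P) (measurable_totalMass hM)
  have hT : Measurable fun m : Measure Ω => m.real univ := measurable_real_univ
  have hd : Measurable fun s => ENNReal.ofReal (Real.exp (-cumulant (totalMass M) P s) *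
      s ^ (ν - 1) / ((negMoment (totalMass M) P ν).toReal * Real.Gamma ν)) := by fun_prop
  rw [gammaQuotientLaw_prod hT hA hB, mixingLaw, restrict_withDensity hB,
    lintegral_withDensity_eq_lintegral_mul _ hd (measurable_expTilt_apply hM hA),
    Measure.restrict_restrict hB]
  refine setLIntegral_congr_fun (hB.inter measurableSet_Ioi) fun s hs => ?_
  have hs : 0 < s := hs.2
  have hm : Measurable fun m : Measure Ω => ENNReal.ofReal
      (Real.exp (cumulant (totalMass M) P s - s * m.real univ)) :=
    (Real.measurable_exp.comp (measurable_const.sub (hT.const_mul s))).ennreal_ofReal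
  rw [Pi.mul_apply, expTilt, withDensity_apply _ hA, ← lintegral_const_mul _ hm]
  refine lintegral_congr fun m => ?_
  rw [← ENNReal.ofReal_mul (by positivity)]
  congr 1
  rw [sub_eq_add_neg (cumulant _ _ _), Real.exp_add, Real.exp_neg (cumulant _ _ _)]
  field_simp

end Tilt

/-! ### The two characterizations of the joint law -/

section JointLaw

variable {X₀ X Ω : Type*} [MeasurableSpace X₀] [MeasurableSpace X] [MeasurableSpace Ω]
  {P₀ : Measure X₀} {M₀ : X₀ → Measure Ω}
  {P : Measure X} [IsProbabilityMeasure P] {M : X → Measure Ω} {ξ : X → ℝ} {ν : ℝ}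

/-- The mixing law of `ξ` together with the tilted conditional law of `M` given `ξ` amounts to a
single identity for the joint law of `(M, ξ)`. -/
lemma mixingLaw_and_hasCondLaw_iff_map_eq [IsProbabilityMeasure P₀] (hM₀ : Measurable M₀)
    (hM : Measurable M) (hξ : Measurable ξ) (hν : 0 < ν) :
    (P.map ξ = mixingLaw (totalMass M₀) P₀ ν ∧
      HasCondLaw M ξ (fun s => expTilt M₀ P₀ s) P) ↔
    P.map (fun x => (M x, ξ x)) = gammaQuotientLaw (P₀.map M₀) (fun m => m.real univ) ν
      (negMoment (totalMass M₀) P₀ ν).toReal := by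
  have hMξ : Measurable fun x => (M x, ξ x) := hM.prodMk hξ
  have := Measure.isProbabilityMeasure_map (μ := P) hMξ.aemeasurable
  have hrect : ∀ {A : Set (Measure Ω)} {B : Set ℝ}, MeasurableSet A → MeasurableSet B →
      P.map (fun x => (M x, ξ x)) (A ×ˢ B) = P (M ⁻¹' A ∩ ξ ⁻¹' B) := fun hA hB => by
    rw [Measure.map_apply hMξ (hA.prod hB), mk_preimage_prod]
  constructor
  · rintro ⟨hmix, -, hcond⟩
    refine Measure.ext_prod fun {A B} hA hB => ?_
    rw [hrect hA hB, hcond A B hA hB, hmix,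
      gammaQuotientLaw_prod_eq_lintegral_expTilt hM₀ hν hA hB]
  · intro hjoint
    have hcond : ∀ (A : Set (Measure Ω)) (B : Set ℝ), MeasurableSet A → MeasurableSet B →
        P (M ⁻¹' A ∩ ξ ⁻¹' B) = ∫⁻ s in B, expTilt M₀ P₀ s A ∂mixingLaw (totalMass M₀) P₀ ν :=
      fun A B hA hB => by
        rw [← hrect hA hB, hjoint, gammaQuotientLaw_prod_eq_lintegral_expTilt hM₀ hν hA hB]
    have hpos : ∀ᵐ s ∂mixingLaw (totalMass M₀) P₀ ν, s ∈ Ioi (0 : ℝ) :=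
      (withDensity_absolutelyContinuous _ _).ae_le (ae_restrict_mem measurableSet_Ioi)
    have hmix : P.map ξ = mixingLaw (totalMass M₀) P₀ ν := by
      ext B hB
      have hone : ∀ᵐ s ∂(mixingLaw (totalMass M₀) P₀ ν).restrict B,
          expTilt M₀ P₀ s univ = 1 :=
        ae_restrict_of_ae (hpos.mono fun s hs => expTilt_univ hM₀ (le_of_lt hs))
      have h := hcond univ B MeasurableSet.univ hB
      rw [preimage_univ, univ_inter, lintegral_congr_ae hone, lintegral_one,
        Measure.restrict_apply_univ] at h
      rw [Measure.map_apply hξ hB, h]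
    exact ⟨hmix, fun A hA => (measurable_expTilt_apply hM₀ hA).aemeasurable,
      fun A B hA hB => by rw [hmix, hcond A B hA hB]⟩

/-- Independence of `M` and a gamma distributed `ξ M(Ω)`, with `M` polynomially tilted, amounts to
a single identity for the joint law of `(M, ξ)`. -/
lemma indepFun_and_map_eq_iff_map_eq [IsProbabilityMeasure P₀] (hM₀ : Measurable M₀)
    (hM : Measurable M) (hξ : Measurable ξ) (hν : 0 < ν) (hmom : negMoment (totalMass M₀) P₀ ν < ∞) :
    (IndepFun M (fun x => ξ x * totalMass M x) P ∧
      P.map (fun x => ξ x * totalMass M x) = gammaMeasure ν 1 ∧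
      P.map M = (P₀.map M₀).withDensity fun m =>
        ENNReal.ofReal (m.real univ) ^ (-ν) / negMoment (totalMass M₀) P₀ ν) ↔
    P.map (fun x => (M x, ξ x)) = gammaQuotientLaw (P₀.map M₀) (fun m => m.real univ) ν
      (negMoment (totalMass M₀) P₀ ν).toReal := by
  have := Measure.isProbabilityMeasure_map (μ := P₀) hM₀.aemeasurable
  have := isProbabilityMeasure_gammaMeasure hν one_pos
  have hT : Measurable fun m : Measure Ω => m.real univ := measurable_real_univ
  have hTM := measurable_totalMass hM
  have hG : Measurable fun x => ξ x * totalMass M x := hξ.mul hTM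
  have hpos := ae_pos_of_negMoment_lt_top hM₀ hν hmom
  have hc := negMoment_toReal_pos hM₀ hν hmom
  have hMξ : Measurable fun x => (M x, ξ x) := hM.prodMk hξ
  have hMG : Measurable fun x => (M x, ξ x * totalMass M x) := hM.prodMk hG
  have hmul : Measurable fun p : Measure Ω × ℝ => (p.1, p.2 * p.1.real univ) := by fun_prop
  have hdiv : Measurable fun p : Measure Ω × ℝ => (p.1, p.2 / p.1.real univ) := by fun_prop
  have hmap := map_mul_gammaQuotientLaw hT hpos hν hc
  have hmap' := map_div_prod_gammaMeasure hT hpos hν hc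
  rw [ENNReal.ofReal_toReal hmom.ne] at hmap hmap'
  set ρ := (P₀.map M₀).withDensity fun m =>
    ENNReal.ofReal (m.real univ) ^ (-ν) / negMoment (totalMass M₀) P₀ ν with hρ
  rw [indepFun_iff_map_prod_eq_prod_map_map hM.aemeasurable hG.aemeasurable]
  constructor
  · rintro ⟨hind, hgamma, htilt⟩
    rw [hgamma, htilt] at hind
    have hposM : ∀ᵐ x ∂P, 0 < totalMass M x := by
      refine ae_of_ae_map hM.aemeasurable (p := fun m : Measure Ω => 0 < m.real univ) ?_
      rw [htilt]
      exact (withDensity_absolutelyContinuous _ _).ae_le hpos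
    -- `ξ` is recovered from `(M, ξ M(Ω))` by division, since `M(Ω) > 0` almost surely
    rw [← hmap', ← hind, Measure.map_map hdiv hMG]
    refine Measure.map_congr (hposM.mono fun x hx => ?_)
    have hx : (M x).real univ ≠ 0 := hx.ne'
    simp [totalMass, hx]
  · intro hjoint
    have hprod : P.map (fun x => (M x, ξ x * totalMass M x)) = ρ.prod (gammaMeasure ν 1) := by
      rw [← hmap, ← hjoint, Measure.map_map hmul hMξ]
      rfl
    have hfst : P.map M = ρ := by
      have h := congrArg Measure.fst hprod
      rwa [Measure.fst_map_prodMk hG, Measure.fst_prod] at h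
    have : IsProbabilityMeasure ρ := hfst ▸ Measure.isProbabilityMeasure_map hM.aemeasurable
    have hsnd : P.map (fun x => ξ x * totalMass M x) = gammaMeasure ν 1 := by
      have h := congrArg Measure.snd hprod
      rwa [Measure.snd_map_prodMk hM, Measure.snd_prod] at h
    exact ⟨by rw [hprod, hfst, hsnd], hsnd, hfst⟩

/-- For weighted versions of the same random measure, the law of the total mass determines the law
of the random measure: the weights are functions of the total mass. -/
lemma map_totalMass_eq_polyTilt_iff {Y : Type*} [MeasurableSpace Y] {Q : Measure Y}
    {N : Y → Measure Ω} {h₀ h : ℝ → ℝ≥0} (hM₀ : IsWeightedBy N Q h₀ M₀ P₀)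
    (hM : IsWeightedBy N Q h M P) :
    P.map (totalMass M) = polyTilt (totalMass M₀) P₀ ν ↔
      P.map M = (P₀.map M₀).withDensity fun m =>
        ENNReal.ofReal (m.real univ) ^ (-ν) / negMoment (totalMass M₀) P₀ ν := by
  have hT : Measurable fun m : Measure Ω => m.real univ := measurable_real_univ
  have hg : Measurable fun t : ℝ =>
      ENNReal.ofReal t ^ (-ν) / negMoment (totalMass M₀) P₀ ν := by fun_prop
  have hmap : P.map (totalMass M) = (P.map M).map fun m => m.real univ :=
    (Measure.map_map hT hM.measurable).symm
  have hmap₀ : P₀.map (totalMass M₀) = (P₀.map M₀).map fun m => m.real univ :=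
    (Measure.map_map hT hM₀.measurable).symm
  rw [polyTilt, hmap, hmap₀]
  constructor
  · intro hlaw
    rw [hM.map_eq, hM₀.map_eq] at hlaw ⊢
    have hf : Measurable fun t => (h t : ℝ≥0∞) := hM.measurable_weight.coe_nnreal_ennreal
    have hf₀ : Measurable fun t => (h₀ t : ℝ≥0∞) := hM₀.measurable_weight.coe_nnreal_ennreal
    have huniv : P.map M univ = ∫⁻ m, (h (m.real univ) : ℝ≥0∞) ∂Q.map N := by
      rw [hM.map_eq, withDensity_apply _ MeasurableSet.univ, Measure.restrict_univ]
    have := Measure.isProbabilityMeasure_map (μ := P) hM.measurable.aemeasurable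
    have hfin : ∫⁻ m, (h (m.real univ) : ℝ≥0∞) ∂Q.map N ≠ ∞ := huniv ▸ measure_ne_top _ _
    have hlaw' := withDensity_comp_eq_of_map_eq (Q.map N) hT hf hf₀ hg hfin hlaw
    exact hlaw'
  · intro hlaw
    rw [hlaw, map_withDensity_comp _ hT hg]

end JointLaw

theorem theorem2
    {Ω : Type*} [TopologicalSpace Ω] [PolishSpace Ω] [MeasurableSpace Ω] [BorelSpace Ω]
    (μ : Measure Ω) [IsProbabilityMeasure μ]
    (lam : ℝ → ℝ) (hlam : IsLevyDensity lam)
    -- the random measure `N`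
    {Y : Type*} [MeasurableSpace Y] (Q : Measure Y) [IsProbabilityMeasure Q]
    (N : Y → Measure Ω) (hN : IsPoissonRandomMeasure lam μ N Q)
    -- the random measure `M₀`
    {X₀ : Type*} [MeasurableSpace X₀] (P₀ : Measure X₀) [IsProbabilityMeasure P₀]
    (M₀ : X₀ → Measure Ω) (h₀ : ℝ → ℝ≥0) (hM₀ : IsWeightedBy N Q h₀ M₀ P₀)
    -- the random measure `M` and the random variable `ξ`
    {X : Type*} [MeasurableSpace X] (P : Measure X) [IsProbabilityMeasure P]
    (M : X → Measure Ω) (h : ℝ → ℝ≥0) (hM : IsWeightedBy N Q h M P)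
    (ξ : X → ℝ) (hξ : Measurable ξ)
    (ν : ℝ) (hν : 0 < ν) (hmom : negMoment (totalMass M₀) P₀ ν < ∞) :
    (IndepFun M (fun x => ξ x * totalMass M x) P ∧
      P.map (fun x => ξ x * totalMass M x) = gammaMeasure ν 1 ∧
      P.map (totalMass M) = polyTilt (totalMass M₀) P₀ ν) ↔
    (P.map ξ = mixingLaw (totalMass M₀) P₀ ν ∧
      HasCondLaw M ξ (fun s => expTilt M₀ P₀ s) P) := by
  rw [map_totalMass_eq_polyTilt_iff hM₀ hM,
    indepFun_and_map_eq_iff_map_eq hM₀.measurable hM.measurable hξ hν hmom,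
    mixingLaw_and_hasCondLaw_iff_map_eq hM₀.measurable hM.measurable hξ hν]
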